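/- Let $q$ be a prime and $a$ an integer with $q\mid a$ and $q^2\nmid a$. Let $j\ge 0$, $m\ge 2$ and $n\ge 1$ be integers with $n<q^jm$, let $c\in\{1,-1\}$, and put $k=q^j$ and $$f(x)=(x^{k}+c)^m-ax^n\in\mathbb{Z}[x].$$ Then $f$ is irreducible in $\mathbb{Z}[x]$. Furthermore, let $K=\mathbb{Q}(\theta)$ be a number field generated by a root $\theta$ of $f$, let $\mathbb{Z}_K$ be its ring of integers, and let $\mathfrak{D}_f$ be the discriminant of $f$. Put $t=\gcd(n,k)$, $n_1=n/t$, $k_1=k/t$ and $$\mathcal{C}=(km)^{k_1m}c^{\,k_1m-n_1},\qquad \mathcal{E}=a^{k_1}n^{n_1}(km-n)^{k_1m-n_1}.$$ Then a prime $p$ dividing $\mathfrak{D}_f$ does not divide the index $[\mathbb{Z}_K:\mathbb{Z}[\theta]]$ if and only if one of the following three (mutually exclusive) conditions holds: 1. $p\mid a$ and $p^2\nmid a$; 2. $p\nmid a$, $p\mid m$, $p\mid n$ and $p^2\nmid a^p-a$; 3. $p\nmid am$ and $p^2\nmid \mathcal{C}-\mathcal{E}$. -/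

import Mathlib

open Polynomial
open scoped NumberField

/-- The polynomial `(x^k + c)^m - a x^n` with integer coefficients. -/
noncomputable def fPoly (a c : ℤ) (k m n : ℕ) : ℤ[X] :=
  (X ^ k + C c) ^ m - C a * X ^ n

/-- The integer `(km)^(k₁ m) c^(k₁ m - n₁)`, where `k₁ = k / gcd(n,k)` and `n₁ = n / gcd(n,k)`.
The natural subtraction in the exponent is exact when `n < k m`. -/
def calC (c : ℤ) (k m n : ℕ) : ℤ :=
  ((k : ℤ) * m) ^ (k / n.gcd k * m) * c ^ (k / n.gcd k * m - n / n.gcd k)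

/-- The integer `a^(k₁) n^(n₁) (km - n)^(k₁ m - n₁)`, where `k₁ = k / gcd(n,k)` and
`n₁ = n / gcd(n,k)`. The natural subtraction in the exponent is exact when `n < k m`. -/
def calE (a : ℤ) (k m n : ℕ) : ℤ :=
  a ^ (k / n.gcd k) * (n : ℤ) ^ (n / n.gcd k) *
    ((k : ℤ) * m - n) ^ (k / n.gcd k * m - n / n.gcd k)

/-- The index `[ℤ_K : ℤ[θ]]` of the additive group of `ℤ[θ]` in that of the ring of integers. -/
noncomputable def indexOf {K : Type*} [Field K] [NumberField K] (θ : 𝓞 K) : ℕ :=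
  (Algebra.adjoin ℤ {θ}).toSubmodule.toAddSubgroup.index

/-!
Write `f = (x ^ k + c) ^ m - a x ^ n` with `k = q ^ j`.

*Irreducibility.* Modulo `q` the Frobenius gives `f = (x + c) ^ (k m)`, while
`f(-c) = ((-c) ^ k + c) ^ m - a (-c) ^ n` is divisible by `q` exactly once, since
`q ∣ (-c) ^ k + c` and `2 ≤ m`. The generalized Eisenstein criterion applies.

*The index.* Dedekind's criterion is used in the form `dvd_indexOf_iff`: a prime `p` divides
`[𝓞 K : ℤ[θ]]` if and only if `f ∈ M ^ 2` for some maximal ideal `M` of `ℤ[X]` containing `p`.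
Such an `M` contains `f` and its derivative `f'`, and because `p ∣ disc f` at least one `M`
contains `p`, `f` and `f'` (`exists_isMaximal_of_dvd_discr`). For every `M` of this kind the
condition `f ∈ M ^ 2` turns out to be equivalent to `p ^ 2 ∣ z` for an integer `z` that does not
depend on `M`. Here one uses that `x ∉ M`, and that an integer lies in `M ^ 2` exactly when
`p ^ 2` divides it.

* If `p ∣ a`, then `x ^ k + c ∈ M`, so `f ≡ -a x ^ n` modulo `M ^ 2`, and `z = a`.
* If `p ∤ a` and `p ∣ m`, then `f' ∈ M` forces `p ∣ n`, so `f = A ^ p - a B ^ p` with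
  `A = (x ^ k + c) ^ (m / p)` and `B = x ^ (n / p)`. The element `A - a B` lies in `M`, whence
  `f ≡ (a ^ p - a) B ^ p` modulo `M ^ 2`, and `z = a ^ p - a`.
* If `p ∤ a m`, then `p ≠ q`, so `p ∤ k`. Put `D = k m - n`. From `f, f' ∈ M` it follows that
  `s = D x ^ k - n c` lies in `M` and that `n` and `D` do not. In `ℤ[X] ⧸ M ^ 2` one has
  `s ^ 2 = 0`, and `D ^ m f` is the difference of `P = (k m c + s) ^ m` and `Q = D ^ m a x ^ n`.
  The powers `P ^ k₁` and `Q ^ k₁` are both explicit in `s`, and to first order they carry the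
  same factor `1 + s / (t c)`; the rest of the difference `P ^ k₁ - Q ^ k₁` is a unit times
  `𝒞 - ℰ`. So `z = 𝒞 - ℰ` (`trinomial_eq_zero_iff`).
-/

/-! ### Maximal ideals of `ℤ[X]` and their squares -/

theorem natCast_dvd_iff_map_eq_zero (p : ℕ) (h : ℤ[X]) :
    (p : ℤ[X]) ∣ h ↔ h.map (Int.castRingHom (ZMod p)) = 0 := by
  have : (p : ℤ[X]) = C (p : ℤ) := by simp
  rw [this, C_dvd_iff_dvd_coeff, Polynomial.ext_iff]
  simp [ZMod.intCast_zmod_eq_zero_iff_dvd]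

/-- An ideal of `ℤ[X]` containing `p` is the preimage of a principal ideal of `(ZMod p)[X]`. -/
theorem exists_mem_iff_map_dvd_map (p : ℕ) [Fact p.Prime] {M : Ideal ℤ[X]}
    (hp : (p : ℤ[X]) ∈ M) :
    ∃ g ∈ M, ∀ h, h ∈ M ↔
      g.map (Int.castRingHom (ZMod p)) ∣ h.map (Int.castRingHom (ZMod p)) := by
  let φ := mapRingHom (Int.castRingHom (ZMod p))
  have hφ : Function.Surjective φ := map_surjective _ (ZMod.ringHom_surjective _)
  obtain ⟨g, hg⟩ := hφ (Submodule.IsPrincipal.generator (M.map φ))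
  have hker : RingHom.ker φ ≤ M := fun h hh => by
    obtain ⟨u, rfl⟩ := (natCast_dvd_iff_map_eq_zero p h).2 hh
    exact M.mul_mem_right _ hp
  have key : ∀ h, h ∈ M ↔ φ g ∣ φ h := fun h => by
    rw [hg, ← Submodule.IsPrincipal.mem_iff_generator_dvd, ← Ideal.mem_comap,
      Ideal.comap_map_of_surjective' _ hφ, sup_eq_left.2 hker]
  exact ⟨g, (key g).2 dvd_rfl, key⟩

theorem exists_eq_span_pair (p : ℕ) [Fact p.Prime] {M : Ideal ℤ[X]}
    (hp : (p : ℤ[X]) ∈ M) : ∃ g, M = Ideal.span {(p : ℤ[X]), g} := by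
  obtain ⟨g, hg, h⟩ := exists_mem_iff_map_dvd_map p hp
  refine ⟨g, le_antisymm (fun x hx => ?_) (Ideal.span_le.2 ?_)⟩
  · obtain ⟨v, hv⟩ := (h x).1 hx
    obtain ⟨v, rfl⟩ := map_surjective (Int.castRingHom (ZMod p)) (ZMod.ringHom_surjective _) v
    rw [← Polynomial.map_mul, ← sub_eq_zero, ← Polynomial.map_sub,
      ← natCast_dvd_iff_map_eq_zero] at hv
    obtain ⟨w, hw⟩ := hv
    rw [Ideal.mem_span_pair]
    exact ⟨w, v, by linear_combination -hw⟩
  · rintro x (rfl | rfl) <;> assumption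

theorem mem_span_pair_sq {R : Type*} [CommRing R] {x y z : R} :
    z ∈ Ideal.span {x, y} ^ 2 ↔ ∃ r s t, z = x ^ 2 * r + x * y * s + y ^ 2 * t := by
  rw [pow_two, Ideal.span_pair_mul_span_pair]
  simp only [Ideal.mem_span_insert, Ideal.mem_span_singleton]
  constructor
  · rintro ⟨r, _, ⟨s, _, ⟨s', _, ⟨t, rfl⟩, rfl⟩, rfl⟩, rfl⟩
    exact ⟨r, s + s', t, by ring⟩
  · rintro ⟨r, s, t, rfl⟩
    exact ⟨r, _, ⟨s, _, ⟨0, _, ⟨t, rfl⟩, rfl⟩, rfl⟩, by ring⟩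

/-- `ℤ[X]` is regular and unramified over `ℤ`: with `M = (p, g)`, a relation
`p = p² r + p g s + g² t` forces `p ∣ g² t`, and dividing by `p` would give `1 ∈ M`. -/
theorem natCast_notMem_sq (p : ℕ) [hp : Fact p.Prime] {M : Ideal ℤ[X]} (hM : M ≠ ⊤)
    (hpM : (p : ℤ[X]) ∈ M) : (p : ℤ[X]) ∉ M ^ 2 := by
  obtain ⟨g, hg⟩ := exists_eq_span_pair p hpM
  intro h
  rw [hg, mem_span_pair_sq] at h
  obtain ⟨r, s, t, h⟩ := h
  have hgM : g ∈ M := hg ▸ Ideal.subset_span (by simp)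
  have h0 : (p : ℤ[X]) ≠ 0 := by exact_mod_cast hp.out.ne_zero
  have hpr : Prime (p : ℤ[X]) := by
    have := (Nat.prime_iff_prime_int.1 hp.out)
    simpa using (prime_C_iff.2 this : Prime (C (p : ℤ)))
  have : (p : ℤ[X]) ∣ g * (g * t) := ⟨1 - p * r - g * s, by linear_combination -h⟩
  have key : ∃ u ∈ M, g * (g * t) = p * u := by
    rcases hpr.dvd_or_dvd this with ⟨g', rfl⟩ | h2
    · exact ⟨g' * (p * g' * t), M.mul_mem_left _ (by
        rw [mul_assoc]; exact M.mul_mem_right _ hpM), by ring⟩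
    · obtain ⟨w, hw⟩ := h2
      exact ⟨g * w, M.mul_mem_right _ hgM, by rw [hw]; ring⟩
  obtain ⟨u, hu, hu'⟩ := key
  refine hM ((Ideal.eq_top_iff_one M).2 ?_)
  have : (1 : ℤ[X]) = p * r + g * s + u :=
    mul_left_cancel₀ h0 (by linear_combination h + hu')
  rw [this]
  exact M.add_mem (M.add_mem (M.mul_mem_right _ hpM) (M.mul_mem_right _ hgM)) hu

theorem derivative_mem_of_mem_sq {M : Ideal ℤ[X]} {f : ℤ[X]} (hf : f ∈ M ^ 2) :
    derivative f ∈ M := by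
  rw [pow_two] at hf
  induction hf using Submodule.mul_induction_on' with
  | mem_mul_mem u hu v hv =>
    rw [derivative_mul]
    exact M.add_mem (M.mul_mem_left _ hv) (M.mul_mem_right _ hu)
  | add x _ y _ hx hy => rw [derivative_add]; exact M.add_mem hx hy

theorem intCast_mem_iff_dvd (p : ℕ) [hp : Fact p.Prime] {M : Ideal ℤ[X]} (hM : M ≠ ⊤)
    (hpM : (p : ℤ[X]) ∈ M) (z : ℤ) : (z : ℤ[X]) ∈ M ↔ (p : ℤ) ∣ z := by
  constructor
  · intro hz
    by_contra h
    obtain ⟨u, v, huv⟩ := ((Nat.prime_iff_prime_int.1 hp.out).coprime_iff_not_dvd).2 h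
    refine hM ((Ideal.eq_top_iff_one M).2 ?_)
    have : (1 : ℤ[X]) = u * p + v * z := by exact_mod_cast huv.symm
    rw [this]
    exact M.add_mem (M.mul_mem_left _ hpM) (M.mul_mem_left _ hz)
  · rintro ⟨w, rfl⟩
    push_cast
    exact M.mul_mem_right _ hpM

/-- The square of a maximal ideal `M` is `M`-primary. -/
theorem mem_sq_of_mul_mem_sq {R : Type*} [CommRing R] {M : Ideal R} [hM : M.IsMaximal] {u x : R}
    (hu : u ∉ M) (h : u * x ∈ M ^ 2) : x ∈ M ^ 2 := by
  obtain ⟨v, w, hw, h1⟩ := hM.exists_inv hu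
  have : x = v * (2 - v * u) * (u * x) + x * w ^ 2 := by
    linear_combination (-x * (v * u + w + 1) + 2 * x * v * u) * h1
  rw [this]
  exact Ideal.add_mem _ (Ideal.mul_mem_left _ _ h)
    (Ideal.mul_mem_left _ _ (Ideal.pow_mem_pow hw 2))

theorem intCast_mem_sq_iff_dvd (p : ℕ) [hp : Fact p.Prime] {M : Ideal ℤ[X]} [hM : M.IsMaximal]
    (hpM : (p : ℤ[X]) ∈ M) (z : ℤ) : (z : ℤ[X]) ∈ M ^ 2 ↔ (p : ℤ) ^ 2 ∣ z := by
  constructor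
  · intro hz
    obtain ⟨w, rfl⟩ := (intCast_mem_iff_dvd p hM.ne_top hpM z).1 (Ideal.pow_le_self two_ne_zero hz)
    by_contra h
    have hw : (w : ℤ[X]) ∉ M := fun hw => h (by
      obtain ⟨v, rfl⟩ := (intCast_mem_iff_dvd p hM.ne_top hpM w).1 hw
      exact ⟨v, by ring⟩)
    refine natCast_notMem_sq p hM.ne_top hpM (mem_sq_of_mul_mem_sq hw ?_)
    push_cast at hz
    rwa [mul_comm]
  · rintro ⟨w, rfl⟩
    push_cast
    exact Ideal.mul_mem_right _ _ (Ideal.pow_mem_pow hpM 2)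

/-! ### The index of `ℤ[θ]` -/

theorem AddSubgroup.prime_dvd_index_iff {A : Type*} [AddCommGroup A] (H : AddSubgroup A)
    [Finite (A ⧸ H)] {p : ℕ} [Fact p.Prime] :
    p ∣ H.index ↔ ∃ x ∉ H, p • x ∈ H := by
  rw [AddSubgroup.index]
  constructor
  · intro h
    obtain ⟨y, hy⟩ := exists_prime_addOrderOf_dvd_card' p h
    obtain ⟨x, rfl⟩ := QuotientAddGroup.mk_surjective y
    obtain ⟨h0, h1⟩ := (addOrderOf_eq_prime_iff).1 hy
    refine ⟨x, fun hx => h1 ((QuotientAddGroup.eq_zero_iff x).2 hx),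
      (QuotientAddGroup.eq_zero_iff _).1 ?_⟩
    simpa using h0
  · rintro ⟨x, hx, hpx⟩
    have : addOrderOf (x : A ⧸ H) = p := addOrderOf_eq_prime_iff.2
      ⟨by simpa using (QuotientAddGroup.eq_zero_iff _).2 hpx,
        fun h => hx ((QuotientAddGroup.eq_zero_iff x).1 h)⟩
    exact this ▸ _root_.addOrderOf_dvd_natCard (x : A ⧸ H)

section Dedekind

theorem coe_aeval {K : Type*} [Field K] (θ : 𝓞 K) (h : ℤ[X]) :
    ((aeval θ h : 𝓞 K) : K) = aeval (θ : K) h :=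
  (aeval_algebraMap_apply K θ h).symm

theorem mem_adjoin_iff_exists_aeval {K : Type*} [Field K] {θ x : 𝓞 K} :
    x ∈ (Algebra.adjoin ℤ {θ}).toSubmodule.toAddSubgroup ↔ ∃ h : ℤ[X], aeval θ h = x := by
  change x ∈ Algebra.adjoin ℤ {θ} ↔ _
  rw [Algebra.adjoin_singleton_eq_range_aeval]
  rfl

variable {K : Type*} [Field K] [NumberField K] {θ : 𝓞 K}

theorem exists_smul_eq_aeval (hgen : IntermediateField.adjoin ℚ {(θ : K)} = ⊤) (x : 𝓞 K) :
    ∃ d : ℤ, d ≠ 0 ∧ ∃ h : ℤ[X], aeval θ h = d • x := by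
  have hx : (x : K) ∈ Algebra.adjoin ℚ {(θ : K)} := by
    rw [← IntermediateField.adjoin_simple_toSubalgebra_of_isAlgebraic
      (Algebra.IsAlgebraic.isAlgebraic _), hgen]
    trivial
  rw [Algebra.adjoin_singleton_eq_range_aeval] at hx
  obtain ⟨h, hh⟩ := hx
  obtain ⟨b, hb, hb'⟩ := IsLocalization.integerNormalization_spec (nonZeroDivisors ℤ) h
  refine ⟨b, nonZeroDivisors.ne_zero hb,
    IsLocalization.integerNormalization (nonZeroDivisors ℤ) h,
    NumberField.RingOfIntegers.ext ?_⟩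
  have := congrArg (aeval (θ : K)) hb'
  rw [aeval_map_algebraMap] at this
  rw [coe_aeval, this]
  simp only [map_zsmul]
  exact congrArg (b • ·) hh

/-- Finiteness is what makes divisibility of `indexOf θ` meaningful: an infinite index would be
recorded as `0`. -/
theorem finite_quotient_adjoin (hgen : IntermediateField.adjoin ℚ {(θ : K)} = ⊤) :
    Finite (𝓞 K ⧸ (Algebra.adjoin ℤ {θ}).toSubmodule.toAddSubgroup) := by
  change Finite (𝓞 K ⧸ (Algebra.adjoin ℤ {θ}).toSubmodule)
  refine Module.finite_of_fg_torsion (𝓞 K ⧸ (Algebra.adjoin ℤ {θ}).toSubmodule) ?_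
  intro y
  obtain ⟨x, rfl⟩ := Submodule.mkQ_surjective _ y
  obtain ⟨d, hd, h, hh⟩ := exists_smul_eq_aeval hgen x
  refine ⟨⟨d, mem_nonZeroDivisors_of_ne_zero hd⟩, ?_⟩
  have : (Algebra.adjoin ℤ {θ}).toSubmodule.mkQ (d • x) = 0 := by
    rw [Submodule.mkQ_apply, Submodule.Quotient.mk_eq_zero]
    exact mem_adjoin_iff_exists_aeval.2 ⟨h, hh⟩
  rwa [map_zsmul] at this

theorem dvd_of_aeval_eq_zero {f : ℤ[X]} (hf : f.Monic) (hirr : Irreducible f)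
    (hθ : aeval θ f = 0) {h : ℤ[X]} (hh : aeval θ h = 0) : f ∣ h := by
  have hint : IsIntegral ℤ θ := ⟨f, hf, hθ⟩
  have h1 := minpoly.isIntegrallyClosed_dvd hint hθ
  have h2 : f ∣ minpoly ℤ θ :=
    (hirr.dvd_iff.1 h1).elim (fun h => absurd h (minpoly.not_isUnit _ _)) (fun h => h.dvd)
  exact h2.trans (minpoly.isIntegrallyClosed_dvd hint hh)

/-- `p` divides the index exactly when some `h(θ) / p` is integral although `h` is not divisible
by `f` modulo `p`. -/
theorem dvd_indexOf_iff_exists_aeval {f : ℤ[X]} (hf : f.Monic) (hirr : Irreducible f)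
    (hθ : aeval θ f = 0) (hgen : IntermediateField.adjoin ℚ {(θ : K)} = ⊤)
    (p : ℕ) [hp : Fact p.Prime] :
    p ∣ indexOf θ ↔ ∃ (x : 𝓞 K) (h : ℤ[X]), aeval θ h = p * x ∧
      ¬ f.map (Int.castRingHom (ZMod p)) ∣ h.map (Int.castRingHom (ZMod p)) := by
  have := finite_quotient_adjoin hgen
  rw [indexOf, AddSubgroup.prime_dvd_index_iff]
  simp only [nsmul_eq_mul, mem_adjoin_iff_exists_aeval]
  have hp0 : (p : 𝓞 K) ≠ 0 := by exact_mod_cast hp.out.ne_zero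
  constructor
  · rintro ⟨x, hx, h, hh⟩
    refine ⟨x, h, hh, fun hdvd => hx ?_⟩
    obtain ⟨v, hv⟩ := hdvd
    obtain ⟨v, rfl⟩ := map_surjective (Int.castRingHom (ZMod p)) (ZMod.ringHom_surjective _) v
    rw [← Polynomial.map_mul, ← sub_eq_zero, ← Polynomial.map_sub,
      ← natCast_dvd_iff_map_eq_zero] at hv
    obtain ⟨w, hw⟩ := hv
    have := congrArg (aeval θ) hw
    simp only [map_sub, map_mul, hθ, hh, map_natCast, zero_mul, sub_zero] at this
    exact ⟨w, (mul_left_cancel₀ hp0 this).symm⟩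
  · rintro ⟨x, h, hh, hnd⟩
    refine ⟨x, fun ⟨w, hw⟩ => hnd ?_, h, hh⟩
    obtain ⟨v, hv⟩ : f ∣ h - p * w :=
      dvd_of_aeval_eq_zero hf hirr hθ (by simp [hh, hw])
    refine ⟨v.map (Int.castRingHom (ZMod p)), ?_⟩
    rw [← Polynomial.map_mul, ← hv]
    simp

/-! ### Dedekind's criterion -/

/-- The polynomials `h` with `h(θ) / p` integral form an ideal that is strictly larger than
`(p, f)`, so it contains a `U` with `f ≡ g U` modulo `p` for some `g` irreducible modulo `p`. For
`M = (p, g)` and `f = g U + p R`, a prime of `𝓞 K` over `M` shows that `U` and `R` lie in `M`. -/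
theorem exists_mem_sq_of_dvd_indexOf {f : ℤ[X]} (hf : f.Monic) (hirr : Irreducible f)
    (hθ : aeval θ f = 0) (hgen : IntermediateField.adjoin ℚ {(θ : K)} = ⊤)
    (p : ℕ) [hp : Fact p.Prime] (hdvd : p ∣ indexOf θ) :
    ∃ M : Ideal ℤ[X], M.IsMaximal ∧ (p : ℤ[X]) ∈ M ∧ f ∈ M ^ 2 := by
  obtain ⟨x, h, hh, hnd⟩ := (dvd_indexOf_iff_exists_aeval hf hirr hθ hgen p).1 hdvd
  have hp0 : (p : 𝓞 K) ≠ 0 := by exact_mod_cast hp.out.ne_zero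
  let φ := mapRingHom (Int.castRingHom (ZMod p))
  have hφ : Function.Surjective φ := map_surjective _ (ZMod.ringHom_surjective _)
  -- `I` consists of the `u` with `u(θ) / p` integral; `d` generates it modulo `p`.
  let I : Ideal ℤ[X] := (Ideal.span {(p : 𝓞 K)}).comap (aeval θ).toRingHom
  have hI : ∀ u, u ∈ I ↔ (p : 𝓞 K) ∣ aeval θ u := fun u => by
    simp only [I, Ideal.mem_comap, Ideal.mem_span_singleton]; rfl
  have hpI : (p : ℤ[X]) ∈ I := by simp [hI]
  obtain ⟨d, hdI, hd⟩ := exists_mem_iff_map_dvd_map p hpI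
  have hfI : f ∈ I := by simp [hI, hθ]
  have hhI : h ∈ I := by simp [hI, hh]
  obtain ⟨e, he⟩ := (hd f).1 hfI
  have hf0 : φ f ≠ 0 := (hf.map _).ne_zero
  have he0 : e ≠ 0 := by rintro rfl; exact hf0 (he.trans (mul_zero _))
  have hunit : ¬ IsUnit e := fun hu => hnd
    (he ▸ (hu.mul_right_dvd).2 ((hd h).1 hhI))
  obtain ⟨g, hg, e', rfl⟩ := WfDvdMonoid.exists_irreducible_factor hunit he0
  obtain ⟨g, rfl⟩ := hφ g
  obtain ⟨e, rfl⟩ := hφ e'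
  let U := d * e
  obtain ⟨y, hy⟩ := (hI U).1 (I.mul_mem_right _ hdI)
  obtain ⟨R, hR⟩ : (p : ℤ[X]) ∣ f - g * U := by
    rw [natCast_dvd_iff_map_eq_zero, Polynomial.map_sub, he]
    simp only [U, Polynomial.map_mul, φ, coe_mapRingHom]
    ring
  have hmax : (Ideal.span {φ g}).IsMaximal := PrincipalIdealRing.isMaximal_of_irreducible hg
  let M := (Ideal.span {φ g}).comap φ
  have hM : M.IsMaximal := Ideal.comap_isMaximal_of_surjective φ hφ
  have hpM : (p : ℤ[X]) ∈ M := by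
    simp only [M, Ideal.mem_comap, Ideal.mem_span_singleton]; simp
  have hgM : g ∈ M := by simp only [M, Ideal.mem_comap, Ideal.mem_span_singleton, dvd_rfl]
  have hfM : f ∈ M := by
    have : f = g * U + p * R := by linear_combination hR
    rw [this]
    exact M.add_mem (M.mul_mem_right _ hgM) (M.mul_mem_right _ hpM)
  algebraize [(aeval (R := ℤ) θ).toRingHom]
  have hint : Algebra.IsIntegral ℤ[X] (𝓞 K) := ⟨fun z =>
    (IsIntegral.tower_top (R := ℤ) (A := ℤ[X]) (Algebra.IsIntegral.isIntegral z))⟩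
  obtain ⟨Q, hQ, hQM⟩ := Ideal.exists_ideal_over_maximal_of_isIntegral (S := 𝓞 K) M (by
    intro u hu
    obtain ⟨v, rfl⟩ := dvd_of_aeval_eq_zero hf hirr hθ (h := u) hu
    exact M.mul_mem_right _ hfM)
  have hQ' : ∀ u, aeval θ u ∈ Q ↔ u ∈ M := fun u => by rw [← hQM]; rfl
  have hUM : U ∈ M := by
    rw [← hQ', hy]
    exact Q.mul_mem_right _ (by simpa using (hQ' p).2 hpM)
  have hRM : R ∈ M := by
    have h1 := congrArg (aeval θ) hR
    simp only [map_sub, map_mul, hθ, hy, map_natCast] at h1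
    have h2 : aeval θ R = - (aeval θ g * y) := mul_left_cancel₀ hp0 (by linear_combination -h1)
    rw [← hQ', h2]
    exact Q.neg_mem (Q.mul_mem_right _ ((hQ' g).2 hgM))
  refine ⟨M, hM, hpM, ?_⟩
  have : f = g * U + p * R := by linear_combination hR
  rw [this, pow_two]
  exact Ideal.add_mem _ (Ideal.mul_mem_mul hgM hUM) (Ideal.mul_mem_mul hpM hRM)

/-- If `M = (p, g)` and `f = p² A + p g B + g² D`, put `U = p B + g D`. Then `U(θ) / p` maps the
image of `M` in `K` to itself, so it is integral, and `U` is not divisible by `f` modulo `p`. -/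
theorem dvd_indexOf_of_mem_sq {f : ℤ[X]} (hf : f.Monic) (hirr : Irreducible f)
    (hθ : aeval θ f = 0) (hgen : IntermediateField.adjoin ℚ {(θ : K)} = ⊤)
    (p : ℕ) [hp : Fact p.Prime] {M : Ideal ℤ[X]} (hM : M.IsMaximal) (hpM : (p : ℤ[X]) ∈ M)
    (hfM : f ∈ M ^ 2) : p ∣ indexOf θ := by
  obtain ⟨g, hg⟩ := exists_eq_span_pair p hpM
  have hgM : g ∈ M := hg ▸ Ideal.subset_span (by simp)
  have h := hfM
  rw [hg, mem_span_pair_sq] at h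
  obtain ⟨A, B, D, hABC⟩ := h
  let U := p * B + g * D
  have hUM : U ∈ M := M.add_mem (M.mul_mem_right _ hpM) (M.mul_mem_right _ hgM)
  have hfU : f = g * U + p * (p * A) := by rw [hABC]; ring
  have hpK : (p : K) ≠ 0 := by exact_mod_cast hp.out.ne_zero
  let N : Submodule ℤ K := (M.restrictScalars ℤ).map (aeval (R := ℤ) (θ : K)).toLinearMap
  have hmem : ∀ u ∈ M, aeval (θ : K) u ∈ N := fun u hu => ⟨u, hu, rfl⟩
  have hθK : aeval (θ : K) f = 0 := by
    rw [← coe_aeval, hθ]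
    rfl
  have hN0 : N ≠ ⊥ := (Submodule.ne_bot_iff _).2 ⟨p, by simpa using hmem p hpM, hpK⟩
  have hNfg : N.FG := by
    let N' : Submodule ℤ (𝓞 K) := (M.restrictScalars ℤ).map (aeval (R := ℤ) θ).toLinearMap
    have hcomp : (aeval (R := ℤ) (θ : K)).toLinearMap =
        ((Algebra.linearMap (𝓞 K) K).restrictScalars ℤ) ∘ₗ (aeval (R := ℤ) θ).toLinearMap :=
      LinearMap.ext fun u => (coe_aeval θ u).symm
    have : N = N'.map ((Algebra.linearMap (𝓞 K) K).restrictScalars ℤ) := by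
      simp only [N, N', hcomp, Submodule.map_comp]
    rw [this]
    exact (IsNoetherian.noetherian N').map _
  have hint : IsIntegral ℤ (aeval (θ : K) U / p) := by
    refine isIntegral_of_smul_mem_submodule N hN0 hNfg _ ?_
    rintro _ ⟨u, hu, rfl⟩
    rw [SetLike.mem_coe, Submodule.restrictScalars_mem, hg, Ideal.mem_span_pair] at hu
    obtain ⟨r, s, rfl⟩ := hu
    have : (aeval (θ : K) U / p) * aeval (θ : K) (r * (p : ℤ[X]) + s * g) =
        aeval (θ : K) (r * U - s * ((p : ℤ[X]) * A)) := by
      have h1 := congrArg (aeval (θ : K)) hfU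
      simp only [hθK, map_add, map_mul, map_natCast] at h1
      simp only [map_add, map_mul, map_sub, map_natCast]
      field_simp
      linear_combination -(aeval (θ : K) s) * h1
    change aeval (θ : K) U / p * aeval (θ : K) (r * (p : ℤ[X]) + s * g) ∈ N
    rw [this]
    exact hmem _ (M.sub_mem (M.mul_mem_left _ hUM) (M.mul_mem_left _ (M.mul_mem_right _ hpM)))
  obtain ⟨y, hy⟩ : ∃ y : 𝓞 K, algebraMap (𝓞 K) K y = aeval (θ : K) U / p := ⟨⟨_, hint⟩, rfl⟩
  refine (dvd_indexOf_iff_exists_aeval hf hirr hθ hgen p).2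
    ⟨y, U, NumberField.RingOfIntegers.ext ?_, fun ⟨W, hW⟩ => ?_⟩
  · rw [coe_aeval]
    change _ = algebraMap (𝓞 K) K (p * y)
    rw [map_mul, map_natCast, hy]
    field_simp
  · -- `f = g * U = g * f * W` modulo `p` would make `g` a unit modulo `p`.
    have h1 := congrArg (Polynomial.map (Int.castRingHom (ZMod p))) hfU
    rw [Polynomial.map_add, Polynomial.map_mul, hW] at h1
    simp only [Polynomial.map_mul, Polynomial.map_natCast, CharP.cast_eq_zero, zero_mul,
      add_zero] at h1
    have h2 : g.map (Int.castRingHom (ZMod p)) * W = 1 :=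
      mul_left_cancel₀ (hf.map (Int.castRingHom (ZMod p))).ne_zero (by linear_combination -h1)
    obtain ⟨W, rfl⟩ := map_surjective (Int.castRingHom (ZMod p)) (ZMod.ringHom_surjective _) W
    rw [← Polynomial.map_mul, ← sub_eq_zero, ← Polynomial.map_one (Int.castRingHom (ZMod p)),
      ← Polynomial.map_sub, ← natCast_dvd_iff_map_eq_zero] at h2
    obtain ⟨v, hv⟩ := h2
    refine hM.ne_top ((Ideal.eq_top_iff_one M).2 ?_)
    have : (1 : ℤ[X]) = g * W - p * v := by linear_combination -hv
    rw [this]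
    exact M.sub_mem (M.mul_mem_right _ hgM) (M.mul_mem_right _ hpM)

/-- **Dedekind's criterion**: `ℤ[θ]` fails to be maximal at `p` exactly when `f` lies in the
square of a maximal ideal of `ℤ[X]` containing `p`. -/
theorem dvd_indexOf_iff {f : ℤ[X]} (hf : f.Monic) (hirr : Irreducible f)
    (hθ : aeval θ f = 0) (hgen : IntermediateField.adjoin ℚ {(θ : K)} = ⊤)
    (p : ℕ) [hp : Fact p.Prime] :
    p ∣ indexOf θ ↔ ∃ M : Ideal ℤ[X], M.IsMaximal ∧ (p : ℤ[X]) ∈ M ∧ f ∈ M ^ 2 :=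
  ⟨exists_mem_sq_of_dvd_indexOf hf hirr hθ hgen p,
    fun ⟨_, hM, hpM, hfM⟩ => dvd_indexOf_of_mem_sq hf hirr hθ hgen p hM hpM hfM⟩

end Dedekind

/-! ### Common zeros of `f` and its derivative -/

/-- If `p ∣ disc f`, the resultant of `f` and `f'` vanishes modulo `p`, so they have a common
factor there. -/
theorem exists_isMaximal_of_dvd_discr {f : ℤ[X]} (hf : f.Monic) (hdeg : 0 < f.degree)
    (p : ℕ) [hp : Fact p.Prime] (hdvd : (p : ℤ) ∣ f.discr) :
    ∃ M : Ideal ℤ[X], M.IsMaximal ∧ (p : ℤ[X]) ∈ M ∧ f ∈ M ∧ derivative f ∈ M := by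
  let φ := mapRingHom (Int.castRingHom (ZMod p))
  have hφ : Function.Surjective φ := map_surjective _ (ZMod.ringHom_surjective _)
  have hres : resultant (φ f) (φ f.derivative) f.natDegree (f.natDegree - 1) = 0 := by
    simp only [φ, coe_mapRingHom]
    rw [resultant_map_map, resultant_deriv hdeg, map_mul]
    simp [(ZMod.intCast_zmod_eq_zero_iff_dvd _ _).2 hdvd]
  have hnat : (φ f).natDegree = f.natDegree := hf.natDegree_map _
  have hnd : (φ f.derivative).natDegree ≤ f.natDegree - 1 :=
    natDegree_map_le.trans (natDegree_derivative_le f)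
  have hlead : (φ f).coeff f.natDegree = 1 := by rw [← hnat]; exact hf.map _
  have hcop : ¬ IsCoprime (φ f) (φ f.derivative) := fun h => by
    refine resultant_ne_zero _ _ h ?_
    -- The degree of `f'` may drop modulo `p`; as `f` is monic, the resultant is not affected.
    obtain ⟨e, he⟩ := Nat.exists_eq_add_of_le hnd
    rwa [he, resultant_add_right_deg _ _ _ _ _ le_rfl, hlead, one_pow, one_mul, ← hnat] at hres
  have hne : Ideal.span {φ f, φ f.derivative} ≠ ⊤ := fun h => hcop (by
    obtain ⟨u, v, h⟩ := Ideal.mem_span_pair.1 ((Ideal.eq_top_iff_one _).1 h)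
    exact ⟨u, v, h⟩)
  obtain ⟨N, hN, hle⟩ := Ideal.exists_le_maximal _ hne
  refine ⟨N.comap φ, Ideal.comap_isMaximal_of_surjective φ hφ, ?_, ?_, ?_⟩
  · rw [Ideal.mem_comap, map_natCast, CharP.cast_eq_zero]
    exact N.zero_mem
  · exact hle (Ideal.subset_span (by simp))
  · exact hle (Ideal.subset_span (by simp))

/-! ### First-order expansion in a ring with square-zero elements -/

theorem isUnit_mk_sq {R : Type*} [CommRing R] {M : Ideal R} [hM : M.IsMaximal] {u : R}
    (hu : u ∉ M) : IsUnit (Ideal.Quotient.mk (M ^ 2) u) := by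
  obtain ⟨v, w, hw, h1⟩ := hM.exists_inv hu
  refine IsUnit.of_mul_eq_one (Ideal.Quotient.mk (M ^ 2) (v * (2 - v * u))) ?_
  rw [← map_mul, ← map_one (Ideal.Quotient.mk (M ^ 2)), Ideal.Quotient.eq]
  have : u * (v * (2 - v * u)) - 1 = -w ^ 2 := by
    linear_combination (w + 1 - v * u) * h1
  rw [this]
  exact (M ^ 2).neg_mem (Ideal.pow_mem_pow hw 2)

theorem mul_add_pow_of_sq_eq_zero {S : Type*} [CommRing S] {s : S} (hs : s ^ 2 = 0) (w : S)
    (e : ℕ) : w * (w + s) ^ e = w ^ e * (w + e * s) := by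
  induction e with
  | zero => simp
  | succ e ih =>
    rw [pow_succ, ← mul_assoc, ih, pow_succ]
    push_cast
    linear_combination (w ^ e * e) * hs

/-- For a unit `T` this says that `(e T + s) ^ e = (e T) ^ e (1 + s / T)`: the first-order factor
does not depend on `e`. -/
theorem mul_natCast_mul_add_pow {S : Type*} [CommRing S] {s : S} (hs : s ^ 2 = 0) (T : S)
    {e : ℕ} (he : IsUnit (e : S)) : T * (e * T + s) ^ e = (e * T) ^ e * (T + s) := by
  refine he.mul_left_cancel ?_
  linear_combination mul_add_pow_of_sq_eq_zero hs (e * T) e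

/-- If `(P - Q) ^ 2 = 0`, then `P ^ e - Q ^ e = e Q ^ (e - 1) (P - Q)`. -/
theorem pow_eq_pow_iff_of_sq_sub_eq_zero {S : Type*} [CommRing S] {P Q : S}
    (h : (P - Q) ^ 2 = 0) (hQ : IsUnit Q) {e : ℕ} (he : IsUnit (e : S)) :
    P ^ e = Q ^ e ↔ P = Q := by
  refine ⟨fun hPQ => ?_, fun hPQ => hPQ ▸ rfl⟩
  have h1 := mul_add_pow_of_sq_eq_zero h Q e
  rw [add_sub_cancel, hPQ] at h1
  rw [← sub_eq_zero]
  refine ((hQ.pow e).mul he).mul_left_cancel ?_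
  linear_combination -h1

/-- Second-order condition at a double root. Here `x` is a double root of
`(X ^ k + c) ^ m - a X ^ n` up to square-zero errors, where `k = k₁ t` and `n = n₁ t`, and `F` and
`D x ^ k - n c`, with `D = k m - n`, are the square-zero elements. Then `F` itself vanishes
if and only if the two integers `𝒞` and `ℰ` agree in `S`. -/
theorem trinomial_eq_zero_iff {S : Type*} [CommRing S] {x : S} {a c : ℤ} {m n₁ k₁ t : ℕ}
    (hc : c ^ 2 = 1) (hle : n₁ ≤ k₁ * m)
    (hx : IsUnit x) (ha : IsUnit (a : S)) (hD : IsUnit (((k₁ * t : ℕ) : S) * m - (n₁ * t : ℕ)))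
    (hm : IsUnit (m : S)) (hk₁ : IsUnit (k₁ : S)) (hn₁ : IsUnit (n₁ : S)) (ht : IsUnit (t : S))
    (hs : ((((k₁ * t : ℕ) : S) * m - (n₁ * t : ℕ)) * x ^ (k₁ * t) - (n₁ * t : ℕ) * c) ^ 2 = 0)
    (hF : ((x ^ (k₁ * t) + c) ^ m - a * x ^ (n₁ * t)) ^ 2 = 0) :
    (x ^ (k₁ * t) + c) ^ m - a * x ^ (n₁ * t) = 0 ↔
      (((((k₁ * t : ℕ) : S) * m) ^ (k₁ * m) * c ^ (k₁ * m - n₁)) -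
        a ^ k₁ * ((n₁ * t : ℕ) : S) ^ n₁ *
          (((k₁ * t : ℕ) : S) * m - (n₁ * t : ℕ)) ^ (k₁ * m - n₁)) = 0 := by
  set D : S := ((k₁ * t : ℕ) : S) * m - (n₁ * t : ℕ) with hDdef
  set s : S := D * x ^ (k₁ * t) - (n₁ * t : ℕ) * c with hsdef
  set F : S := (x ^ (k₁ * t) + c) ^ m - a * x ^ (n₁ * t) with hFdef
  have hcS : (c : S) ^ 2 = 1 := by exact_mod_cast congrArg (Int.cast : ℤ → S) hc
  have hcu : IsUnit (c : S) := IsUnit.of_mul_eq_one (c : S) (by rw [← hcS]; ring)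
  obtain ⟨d, hd⟩ := Nat.exists_eq_add_of_le hle
  -- `k m c = (k₁ m) T` and `n c = n₁ T`, so both expansions below have the factor `T + s`.
  set T : S := t * c with hT
  have hTu : IsUnit T := ht.mul hcu
  set P : S := (D * (x ^ (k₁ * t) + c)) ^ m with hP
  set Q : S := D ^ m * (a * x ^ (n₁ * t)) with hQ
  have hPQ : D ^ m * F = P - Q := by rw [hP, hQ, hFdef, mul_pow]; ring
  have hQu : IsUnit Q := (hD.pow m).mul (ha.mul (hx.pow _))
  have h1 : F = 0 ↔ P ^ k₁ = Q ^ k₁ := by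
    rw [pow_eq_pow_iff_of_sq_sub_eq_zero (by rw [← hPQ, mul_pow, hF, mul_zero]) hQu hk₁,
      ← sub_eq_zero (a := P), ← hPQ, (hD.pow m).mul_right_eq_zero]
  have hPT : T * P ^ k₁ = ((k₁ * m : ℕ) * T) ^ (k₁ * m) * (T + s) := by
    rw [← mul_natCast_mul_add_pow hs T (e := k₁ * m) (by push_cast; exact hk₁.mul hm), hP,
      ← pow_mul, mul_comm m k₁]
    congr 2
    rw [hsdef, hDdef, hT]
    push_cast
    ring
  have hQT : T * Q ^ k₁ = a ^ k₁ * D ^ d * ((n₁ * T) ^ n₁ * (T + s)) := by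
    have : D * x ^ (k₁ * t) = n₁ * T + s := by
      rw [hsdef, hT]
      push_cast
      ring
    rw [← mul_natCast_mul_add_pow hs T hn₁, ← this, hQ, mul_pow, mul_pow, mul_pow, ← pow_mul,
      ← pow_mul, ← pow_mul, mul_comm m k₁, hd, pow_add]
    rw [show n₁ * t * k₁ = k₁ * t * n₁ by ring]
    ring
  have hTs : IsUnit (T + s) := by
    refine isUnit_of_mul_isUnit_left (y := T - s) ?_
    rw [show (T + s) * (T - s) = T ^ 2 by linear_combination -hs]
    exact hTu.pow 2
  rw [h1, ← hTu.mul_right_inj, hPT, hQT, ← sub_eq_zero]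
  have hu : IsUnit ((c : S) ^ n₁ * (T + s)) := (hcu.pow _).mul hTs
  rw [hd, Nat.add_sub_cancel_left]
  refine Iff.trans (Eq.congr ?_ rfl) hu.mul_right_eq_zero
  have e1 : ((k₁ * m : ℕ) : S) * T = (k₁ * t : ℕ) * m * c := by rw [hT]; push_cast; ring
  have e2 : (n₁ : S) * T = (n₁ * t : ℕ) * c := by rw [hT]; push_cast; ring
  rw [← hd, e1, e2, mul_pow _ (c : S), mul_pow _ (c : S) n₁]
  nth_rewrite 2 [hd]
  rw [pow_add (c : S)]
  ring

/-! ### Irreducibility -/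

theorem fPoly_monic (a c : ℤ) {k m n : ℕ} (hk : 0 < k) (hnm : n < k * m) :
    (fPoly a c k m n).Monic ∧ (fPoly a c k m n).natDegree = k * m := by
  have h1 : ((X ^ k + C c : ℤ[X]) ^ m).Monic := (monic_X_pow_add_C c hk.ne').pow m
  have h2 : ((X ^ k + C c : ℤ[X]) ^ m).natDegree = k * m := by
    rw [(monic_X_pow_add_C c hk.ne').natDegree_pow, natDegree_X_pow_add_C, mul_comm]
  have h3 : (C a * X ^ n : ℤ[X]).degree < ((X ^ k + C c : ℤ[X]) ^ m).degree := by
    rw [degree_eq_natDegree h1.ne_zero, h2]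
    exact (degree_C_mul_X_pow_le n a).trans_lt (by exact_mod_cast hnm)
  refine ⟨h1.sub_of_left h3, ?_⟩
  rw [fPoly, natDegree_eq_of_degree_eq (degree_sub_eq_left_of_degree_lt h3), h2]

theorem fPoly_irreducible {q : ℕ} (hq : q.Prime) {a : ℤ} (hqa : (q : ℤ) ∣ a)
    (hqa2 : ¬ (q : ℤ) ^ 2 ∣ a) {m n j : ℕ} (hm : 2 ≤ m) (hnm : n < q ^ j * m)
    {c : ℤ} (hc : c = 1 ∨ c = -1) : Irreducible (fPoly a c (q ^ j) m n) := by
  have := Fact.mk hq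
  obtain ⟨hmon, hdeg⟩ := fPoly_monic a c (pow_pos hq.pos j) hnm
  have hker : RingHom.ker (algebraMap ℤ (ZMod q)) = Ideal.span {(q : ℤ)} := ZMod.ker_intCastRingHom q
  refine generalizedEisenstein (K := ZMod q) (q := X + C c) (p := q ^ j * m) ?_ (monic_X_add_C c)
    hmon.isPrimitive (by rw [hdeg]; exact Nat.pos_of_ne_zero (by lia)) (by simp [hmon]) ?_ ?_
  · simpa using irreducible_of_degree_eq_one (degree_X_add_C (c : ZMod q))
  · have ha : algebraMap ℤ (ZMod q) a = 0 := (ZMod.intCast_zmod_eq_zero_iff_dvd a q).2 hqa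
    rw [hmon.leadingCoeff, fPoly, pow_mul]
    simp only [Polynomial.map_sub, Polynomial.map_mul, Polynomial.map_pow, Polynomial.map_add,
      map_X, map_C, ha]
    rw [add_pow_char_pow, ← C_pow, ZMod.pow_card_pow]
    simp
  · have hX : (X + C c : ℤ[X]) = X - C (-c) := by simp
    rw [hX, modByMonic_X_sub_C_eq_C_eval, map_C, hker, Ideal.span_singleton_pow]
    rw [Ne, C_eq_zero, Ideal.Quotient.eq_zero_iff_mem, Ideal.mem_span_singleton]
    simp only [fPoly, eval_sub, eval_mul, eval_pow, eval_add, eval_X, eval_C]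
    intro h
    -- By Fermat `q ∣ (-c) ^ (q ^ j) + c`, also for `q = 2`, where this may be `2` instead of `0`.
    have h1 : (q : ℤ) ^ 2 ∣ ((-c) ^ q ^ j + c) ^ m := by
      refine (pow_dvd_pow_of_dvd ?_ 2).trans (pow_dvd_pow _ hm)
      rw [← ZMod.intCast_zmod_eq_zero_iff_dvd]
      push_cast
      rw [ZMod.pow_card_pow]
      ring
    have h2 : (q : ℤ) ^ 2 ∣ a * (-c) ^ n := by
      have := dvd_sub h1 h
      rwa [sub_sub_cancel] at this
    refine hqa2 ?_
    have hcu : IsUnit ((-c) ^ n) := by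
      refine IsUnit.pow _ ?_
      rcases hc with rfl | rfl <;> simp
    exact hcu.dvd_mul_right.1 h2

/-! ### Membership of `f` in the square of a maximal ideal -/

section

variable {a c : ℤ} {k m n : ℕ} {M : Ideal ℤ[X]} [hM : M.IsMaximal]

theorem C_notMem_of_sq_eq_one (hc : c ^ 2 = 1) : (C c : ℤ[X]) ∉ M := fun h => by
  refine hM.ne_top ((Ideal.eq_top_iff_one M).2 ?_)
  have : (1 : ℤ[X]) = C c * C c := by rw [← C_mul, ← pow_two, hc, C_1]
  rw [this]
  exact M.mul_mem_left _ h

theorem X_notMem (hc : c ^ 2 = 1) (hk : 0 < k) (hn : 0 < n) (hf : fPoly a c k m n ∈ M) :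
    (X : ℤ[X]) ∉ M := fun h => by
  have h1 : (X ^ k + C c : ℤ[X]) ^ m ∈ M := by
    have : (X ^ k + C c : ℤ[X]) ^ m = fPoly a c k m n + C a * X ^ n := by rw [fPoly]; ring
    rw [this]
    exact M.add_mem hf (M.mul_mem_left _ (M.pow_mem_of_mem h n hn))
  have h2 := hM.isPrime.mem_of_pow_mem _ h1
  exact C_notMem_of_sq_eq_one (M := M) hc
    ((M.add_mem_iff_right (M.pow_mem_of_mem h k hk)).1 h2)

theorem fPoly_mem_sq_iff_of_dvd (p : ℕ) [hp : Fact p.Prime] (hpM : (p : ℤ[X]) ∈ M)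
    (hc : c ^ 2 = 1) (hk : 0 < k) (hm : 2 ≤ m) (hn : 0 < n) (hf : fPoly a c k m n ∈ M)
    (hpa : (p : ℤ) ∣ a) : fPoly a c k m n ∈ M ^ 2 ↔ (p : ℤ) ^ 2 ∣ a := by
  have hX := X_notMem hc hk hn hf
  have haM : (C a : ℤ[X]) ∈ M := by simpa using (intCast_mem_iff_dvd p hM.ne_top hpM a).2 hpa
  have h1 : (X ^ k + C c : ℤ[X]) ∈ M := by
    refine hM.isPrime.mem_of_pow_mem m ?_
    have : (X ^ k + C c : ℤ[X]) ^ m = fPoly a c k m n + C a * X ^ n := by rw [fPoly]; ring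
    rw [this]
    exact M.add_mem hf (M.mul_mem_right _ haM)
  have h2 : (X ^ k + C c : ℤ[X]) ^ m ∈ M ^ 2 := Ideal.pow_le_pow_right hm (Ideal.pow_mem_pow h1 m)
  rw [fPoly, (M ^ 2).sub_mem_iff_right h2, ← intCast_mem_sq_iff_dvd p hpM]
  have hXn : (X ^ n : ℤ[X]) ∉ M := fun h => hX (hM.isPrime.mem_of_pow_mem n h)
  refine ⟨fun h => ?_, fun h => ?_⟩
  · rw [mul_comm] at h
    simpa using mem_sq_of_mul_mem_sq hXn h
  · simpa using (M ^ 2).mul_mem_right (X ^ n) h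

theorem add_pow_prime_sub_pow_mem_sq {R : Type*} [CommRing R] {I : Ideal R} (p : ℕ)
    (hp : p.Prime) (hpI : (p : R) ∈ I) {x : R} (hx : x ∈ I) (y : R) :
    (x + y) ^ p - y ^ p ∈ I ^ 2 := by
  obtain ⟨r, hr⟩ := exists_add_pow_prime_eq hp x y
  rw [hr]
  have : x ^ p + y ^ p + p * x * y * r - y ^ p = x ^ p + p * x * (y * r) := by ring
  rw [this, pow_two]
  exact Ideal.add_mem _ (pow_two I ▸ Ideal.pow_le_pow_right hp.two_le (Ideal.pow_mem_pow hx p))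
    (Ideal.mul_mem_right _ _ (Ideal.mul_mem_mul hpI hx))

theorem fPoly_mem_sq_iff_of_dvd_of_dvd (p : ℕ) [hp : Fact p.Prime] (hpM : (p : ℤ[X]) ∈ M)
    (hc : c ^ 2 = 1) (hk : 0 < k) (hn : 0 < n) (hf : fPoly a c k m n ∈ M)
    (hpm : p ∣ m) (hpn : p ∣ n) :
    fPoly a c k m n ∈ M ^ 2 ↔ (p : ℤ) ^ 2 ∣ a ^ p - a := by
  have hX := X_notMem hc hk hn hf
  obtain ⟨m, rfl⟩ := hpm
  obtain ⟨n, rfl⟩ := hpn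
  set H : ℤ[X] := (X ^ k + C c) ^ m - C a * X ^ n with hH
  have hXn : ((X ^ n) ^ p : ℤ[X]) ∉ M := fun h =>
    hX (hM.isPrime.mem_of_pow_mem n (hM.isPrime.mem_of_pow_mem p h))
  have hfe : fPoly a c k (p * m) (p * n) =
      ((H + C a * X ^ n) ^ p - (C a * X ^ n) ^ p) + (X ^ n) ^ p * ((a ^ p - a : ℤ) : ℤ[X]) := by
    rw [hH, fPoly, sub_add_cancel, ← pow_mul, ← pow_mul, mul_pow, mul_comm m, mul_comm n, pow_mul X]
    push_cast
    ring_nf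
    simp only [eq_intCast]
    ring
  have hap : ((a ^ p - a : ℤ) : ℤ[X]) ∈ M := by
    rw [intCast_mem_iff_dvd p hM.ne_top hpM, ← ZMod.intCast_zmod_eq_zero_iff_dvd]
    push_cast
    rw [ZMod.pow_card, sub_self]
  -- Modulo `p`, `f` is the `p`-th power of `H`.
  have hHM : H ∈ M := by
    refine hM.isPrime.mem_of_pow_mem p ?_
    obtain ⟨r, hr⟩ := exists_add_pow_prime_eq hp.out H (C a * X ^ n)
    have : H ^ p = fPoly a c k (p * m) (p * n) - (p : ℤ[X]) * (H * (C a * X ^ n) * r) -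
        (X ^ n) ^ p * ((a ^ p - a : ℤ) : ℤ[X]) := by
      rw [hfe, hr]
      ring
    rw [this]
    exact M.sub_mem (M.sub_mem hf (M.mul_mem_right _ hpM)) (M.mul_mem_left _ hap)
  rw [hfe, (M ^ 2).add_mem_iff_right (add_pow_prime_sub_pow_mem_sq p hp.out hpM hHM _),
    ← intCast_mem_sq_iff_dvd p hpM]
  exact ⟨mem_sq_of_mul_mem_sq hXn, (M ^ 2).mul_mem_left _⟩

theorem X_mul_derivative_fPoly (hk : 0 < k) (hm : 0 < m) (hn : 0 < n) :
    X * derivative (fPoly a c k m n) =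
      ((k * m : ℕ) : ℤ[X]) * X ^ k * (X ^ k + C c) ^ (m - 1) - C a * (n : ℤ[X]) * X ^ n := by
  obtain ⟨k, rfl⟩ := Nat.exists_eq_add_of_le' hk
  obtain ⟨m, rfl⟩ := Nat.exists_eq_add_of_le' hm
  obtain ⟨n, rfl⟩ := Nat.exists_eq_add_of_le' hn
  simp only [fPoly, derivative_sub, derivative_pow_succ, derivative_mul, derivative_add,
    derivative_C, derivative_X]
  simp only [Nat.add_sub_cancel]
  push_cast
  simp
  ring

theorem natCast_mem_iff_dvd (p : ℕ) [hp : Fact p.Prime] (hpM : (p : ℤ[X]) ∈ M) (z : ℕ) :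
    (z : ℤ[X]) ∈ M ↔ p ∣ z := by
  have := intCast_mem_iff_dvd p hM.ne_top hpM z
  rw [Int.natCast_dvd_natCast] at this
  exact_mod_cast this

theorem dvd_of_derivative_fPoly_mem (p : ℕ) [hp : Fact p.Prime] (hpM : (p : ℤ[X]) ∈ M)
    (hc : c ^ 2 = 1) (hk : 0 < k) (hm : 0 < m) (hn : 0 < n) (hf : fPoly a c k m n ∈ M)
    (hf' : derivative (fPoly a c k m n) ∈ M) (hpa : ¬ (p : ℤ) ∣ a) (hpm : p ∣ m) : p ∣ n := by
  have hX := X_notMem hc hk hn hf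
  have ha : (C a : ℤ[X]) ∉ M := fun h => hpa
    ((intCast_mem_iff_dvd p hM.ne_top hpM a).1 (by simpa using h))
  have h1 := M.mul_mem_left X hf'
  rw [X_mul_derivative_fPoly hk hm hn, mul_assoc, M.sub_mem_iff_right (M.mul_mem_right _
    ((natCast_mem_iff_dvd p hpM _).2 (hpm.mul_left k)))] at h1
  rcases hM.isPrime.mem_or_mem h1 with h | h
  · exact (natCast_mem_iff_dvd p hpM n).1 ((hM.isPrime.mem_or_mem h).resolve_left ha)
  · exact absurd (hM.isPrime.mem_of_pow_mem n h) hX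

theorem fPoly_mem_sq_iff_of_not_dvd (p : ℕ) [hp : Fact p.Prime] (hpM : (p : ℤ[X]) ∈ M)
    (hc : c ^ 2 = 1) (hk : 0 < k) (hm : 0 < m) (hn : 0 < n) (hnm : n < k * m)
    (hf : fPoly a c k m n ∈ M) (hf' : derivative (fPoly a c k m n) ∈ M)
    (hpa : ¬ (p : ℤ) ∣ a) (hpm : ¬ p ∣ m) (hpk : ¬ p ∣ k) :
    fPoly a c k m n ∈ M ^ 2 ↔ (p : ℤ) ^ 2 ∣ calC c k m n - calE a k m n := by
  have hX := X_notMem hc hk hn hf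
  have hprime := hM.isPrime
  have ha : (C a : ℤ[X]) ∉ M := fun h => hpa
    ((intCast_mem_iff_dvd p hM.ne_top hpM a).1 (by simpa using h))
  have haX : (C a * X ^ n : ℤ[X]) ∉ M := hprime.mul_notMem ha
    (fun h => hX (hprime.mem_of_pow_mem n h))
  set s : ℤ[X] := ((k : ℤ[X]) * (m : ℤ[X]) - (n : ℤ[X])) * X ^ k - (n : ℤ[X]) * C c with hs
  have hsM : s ∈ M := by
    have : C a * X ^ n * s = (X ^ k + C c) * (X * derivative (fPoly a c k m n)) -
        ((k * m : ℕ) : ℤ[X]) * X ^ k * fPoly a c k m n := by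
      obtain ⟨m, rfl⟩ := Nat.exists_eq_add_of_le' hm
      rw [X_mul_derivative_fPoly hk hm hn, hs, fPoly, Nat.add_sub_cancel]
      push_cast
      ring
    refine (hprime.mem_or_mem (this ▸ M.sub_mem (M.mul_mem_left _ (M.mul_mem_left _ hf'))
      (M.mul_mem_left _ hf))).resolve_left haX
  have hkm : ((k : ℤ[X]) * (m : ℤ[X])) ∉ M := hprime.mul_notMem
    (fun h => hpk ((natCast_mem_iff_dvd p hpM k).1 h))
    (fun h => hpm ((natCast_mem_iff_dvd p hpM m).1 h))
  have hnM : (n : ℤ[X]) ∉ M := fun h => by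
    have : (k : ℤ[X]) * (m : ℤ[X]) * X ^ k = s + (n : ℤ[X]) * (X ^ k + C c) := by rw [hs]; ring
    exact hprime.mul_notMem hkm (fun h => hX (hprime.mem_of_pow_mem k h))
      (this ▸ M.add_mem hsM (M.mul_mem_right _ h))
  have hDM : ((k : ℤ[X]) * (m : ℤ[X]) - (n : ℤ[X])) ∉ M := fun h => by
    have : (n : ℤ[X]) * C c = ((k : ℤ[X]) * (m : ℤ[X]) - (n : ℤ[X])) * X ^ k - s := by rw [hs]; ring
    exact hprime.mul_notMem hnM (C_notMem_of_sq_eq_one hc)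
      (this ▸ M.sub_mem (M.mul_mem_right _ h) hsM)
  obtain ⟨t, ht⟩ : ∃ t, t = n.gcd k := ⟨_, rfl⟩
  have ht0 : 0 < t := ht ▸ Nat.gcd_pos_of_pos_left _ hn
  obtain ⟨n₁, hn₁⟩ : t ∣ n := ht ▸ Nat.gcd_dvd_left n k
  obtain ⟨k₁, hk₁⟩ : t ∣ k := ht ▸ Nat.gcd_dvd_right n k
  have hnd : n / n.gcd k = n₁ := by rw [← ht, hn₁, Nat.mul_div_cancel_left _ ht0]
  have hkd : k / n.gcd k = k₁ := by rw [← ht, hk₁, Nat.mul_div_cancel_left _ ht0]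
  have hle : n₁ ≤ k₁ * m := by
    rw [hn₁, hk₁, mul_assoc] at hnm
    exact (lt_of_mul_lt_mul_left hnm (Nat.zero_le t)).le
  rw [mul_comm] at hn₁ hk₁
  have hpn : ¬ p ∣ n := fun h => hnM ((natCast_mem_iff_dvd p hpM n).2 h)
  -- Units of `ℤ[X] ⧸ M ^ 2` are the classes of the elements outside `M`.
  have hunit : ∀ z : ℕ, ¬ p ∣ z → IsUnit ((z : ℕ) : ℤ[X] ⧸ M ^ 2) := fun z hz => by
    simpa using isUnit_mk_sq (M := M) (fun h => hz ((natCast_mem_iff_dvd p hpM z).1 h))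
  have key := trinomial_eq_zero_iff (x := Ideal.Quotient.mk (M ^ 2) X) (a := a) (c := c)
    (m := m) (t := t) hc hle (isUnit_mk_sq hX) (by simpa using isUnit_mk_sq ha)
    (by simpa [← hn₁, ← hk₁] using isUnit_mk_sq hDM)
    (hunit m hpm) (hunit k₁ fun h => hpk (hk₁ ▸ h.mul_right t))
    (hunit n₁ fun h => hpn (hn₁ ▸ h.mul_right t)) (hunit t fun h => hpn (hn₁ ▸ h.mul_left n₁))
    (by
      have := (Ideal.Quotient.eq_zero_iff_mem).2 (Ideal.pow_mem_pow hsM 2)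
      simpa [← hn₁, ← hk₁, hs] using this)
    (by
      have := (Ideal.Quotient.eq_zero_iff_mem).2 (Ideal.pow_mem_pow hf 2)
      simpa [← hn₁, ← hk₁, fPoly] using this)
  rw [← intCast_mem_sq_iff_dvd p hpM, ← Ideal.Quotient.eq_zero_iff_mem,
    ← Ideal.Quotient.eq_zero_iff_mem, calC, calE, hnd, hkd]
  rw [← hn₁, ← hk₁] at key
  simpa [fPoly] using key

end

/-! ### Monogenicity at `p` -/

theorem corollary2p5 (q : ℕ) (hq : q.Prime) (a : ℤ) (hqa : (q : ℤ) ∣ a) (hqa2 : ¬ (q : ℤ) ^ 2 ∣ a)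
    (m n j : ℕ) (hm : 2 ≤ m) (hn : 1 ≤ n) (hnm : n < q ^ j * m)
    (c : ℤ) (hc : c = 1 ∨ c = -1) :
    Irreducible (fPoly a c (q ^ j) m n) ∧
    ∀ (K : Type*) [Field K] [NumberField K] (θ : 𝓞 K),
      aeval θ (fPoly a c (q ^ j) m n) = 0 →
      IntermediateField.adjoin ℚ {(θ : K)} = ⊤ →
      ∀ p : ℕ, p.Prime → (p : ℤ) ∣ (fPoly a c (q ^ j) m n).discr →
        (¬ p ∣ indexOf θ ↔
          ((p : ℤ) ∣ a ∧ ¬ (p : ℤ) ^ 2 ∣ a) ∨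
          (¬ (p : ℤ) ∣ a ∧ p ∣ m ∧ p ∣ n ∧ ¬ (p : ℤ) ^ 2 ∣ a ^ p - a) ∨
          (¬ (p : ℤ) ∣ a * m ∧ ¬ (p : ℤ) ^ 2 ∣ calC c (q ^ j) m n - calE a (q ^ j) m n)) := by
  have hirr := fPoly_irreducible hq hqa hqa2 hm hnm hc
  refine ⟨hirr, fun K _ _ θ hθ hgen p hp hdvd => ?_⟩
  have := Fact.mk hp
  have hc2 : c ^ 2 = 1 := by rcases hc with rfl | rfl <;> norm_num
  have hk : 0 < q ^ j := pow_pos hq.pos j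
  have hm0 : 0 < m := by lia
  obtain ⟨hmon, hdeg⟩ := fPoly_monic a c hk hnm
  obtain ⟨M₀, hM₀, hpM₀, hfM₀, hfM₀'⟩ := exists_isMaximal_of_dvd_discr hmon
    (natDegree_pos_iff_degree_pos.1 (by rw [hdeg]; positivity)) p hdvd
  have hprime : Prime (p : ℤ) := Nat.prime_iff_prime_int.1 hp
  -- If membership in `M ^ 2` is governed by one integer `z`, uniformly in `M`, so is the index:
  -- the ideal `M₀` provides an `M` to start from when `p ^ 2 ∣ z`.
  have key : ∀ z : ℤ, (∀ M : Ideal ℤ[X], M.IsMaximal → (p : ℤ[X]) ∈ M →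
      fPoly a c (q ^ j) m n ∈ M → derivative (fPoly a c (q ^ j) m n) ∈ M →
      (fPoly a c (q ^ j) m n ∈ M ^ 2 ↔ (p : ℤ) ^ 2 ∣ z)) →
      (p ∣ indexOf θ ↔ (p : ℤ) ^ 2 ∣ z) := by
    intro z hz
    rw [dvd_indexOf_iff hmon hirr hθ hgen p]
    refine ⟨fun ⟨M, hM, hpM, hfM⟩ => (hz M hM hpM (Ideal.pow_le_self two_ne_zero hfM)
      (derivative_mem_of_mem_sq hfM)).1 hfM, fun h => ⟨M₀, hM₀, hpM₀, ?_⟩⟩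
    exact (hz M₀ hM₀ hpM₀ hfM₀ hfM₀').2 h
  by_cases hpa : (p : ℤ) ∣ a
  · rw [key a fun M hM hpM hf _ => fPoly_mem_sq_iff_of_dvd p hpM hc2 hk hm hn hf hpa]
    simp [hpa, hpa.mul_right]
  by_cases hpm : p ∣ m
  · have hpn := dvd_of_derivative_fPoly_mem p hpM₀ hc2 hk hm0 hn hfM₀ hfM₀' hpa hpm
    rw [key (a ^ p - a) fun M hM hpM hf _ =>
      fPoly_mem_sq_iff_of_dvd_of_dvd p hpM hc2 hk hn hf hpm hpn]
    have : (p : ℤ) ∣ a * m := (Int.natCast_dvd_natCast.2 hpm).mul_left a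
    simp [hpa, hpm, hpn, this]
  · -- `p ∣ q ^ j` would mean `p = q`, which divides `a`.
    have hpk : ¬ p ∣ q ^ j := fun h => hpa <| by
      rwa [(Nat.prime_dvd_prime_iff_eq hp hq).1 (hp.dvd_of_dvd_pow h)]
    rw [key _ fun M hM hpM hf hf' =>
      fPoly_mem_sq_iff_of_not_dvd p hpM hc2 hk hm0 hn hnm hf hf' hpa hpm hpk]
    have : ¬ (p : ℤ) ∣ a * m := hprime.not_dvd_mul hpa (by rwa [Int.natCast_dvd_natCast])
    simp [hpa, hpm, this]
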